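/- **Setting.** A *$t$-query adaptive quantum algorithm* on $V=\mathbb{C}^X$ ($X$ a finite set) with outputs in a finite set $G$ consists of an integer $N\ge 0$ (workspace dimension), a unit vector $\psi\in V\otimes\mathbb{C}^N$, unitary operators $U_1,\dots,U_t$ on $V\otimes\mathbb{C}^N$, and a POVM $\{E_g\}_{g\in G}$ on $V\otimes\mathbb{C}^N$. On an oracle $\pi(a)\in U(V)$ it produces $$\psi_a=U_t(\pi(a)\otimes I)U_{t-1}(\pi(a)\otimes I)\cdots U_1(\pi(a)\otimes I)\psi .$$ A *$t$-query nonadaptive quantum algorithm* consists of $N$, a unit vector $\psi\in V^{\otimes t}\otimes\mathbb{C}^N$ and a POVM $\{E_g\}_{g\in G}$ on $V^{\otimes t}\otimes\mathbb{C}^N$, and produces $\psi_a=(\pi(a)^{\otimes t}\otimes I)\psi$. If $G$ is a finite group acting on $X$, let $\pi:G\to U(\mathbb{C}^X)$ be the corresponding representation by permutation matrices. In the *oracle identification problem* the hidden element $a$ is uniform in $G$ and is to be identified, so the success probability of an algorithm is $$\frac{1}{|G|}\sum_{a\in G}\langle\psi_a|E_a|\psi_a\rangle .$$ The *base size* of the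 action (its classical query complexity) is the least $t$ for which there are $x_1,\dots,x_t\in X$ such that only $g=1$ satisfies $g x_i=x_i$ for all $i$. **Theorem.** Let $p$ be a prime and let $n$ be a positive integer. Let $G(p,n)$ be the Heisenberg group of all $(n+2)\times(n+2)$ matrices over $\mathbb{Z}_p=\mathbb{Z}/p\mathbb{Z}$ with $1$'s on the main diagonal and whose only other nonzero entries are in the first row and the last column, acting by multiplication on the set of column vectors $X=\mathbb{Z}_p^{n+2}$. Then, among the adaptive as well as among the nonadaptive single-query quantum algorithms, the maximal success probability for the oracle identification problem exists and equals $$P_{\rm opt}=1-\frac1p+\frac{2}{p^{n+1}}-\frac{1}{p^{2n+1}} .$$ Furthermore, two queries suffice to solve the oracle identification problem with probability $1$: both an adaptive and a nonadaptive two-query quantum algorithm with success probability $1$ exist. The base size of the action of $G(p,n)$ on $X$ is $n+1$. -/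

import Mathlib

open scoped Kronecker Matrix ComplexOrder

/-! ## Quantum oracle problems

The Hilbert space `V = ℂ^ι` is given with its standard orthonormal basis, indexed by a finite
type `ι`.  Then `V ⊗ ℂ^N` has the basis `ι × Fin N`, and `V^{⊗ t}` has the basis `Fin t → ι`.
A quantum oracle problem is a map `π : Y → U(V)` together with a function `f : Y → X` to learn. -/

namespace QuantumOracle

/-- A positive operator-valued measure on `ℂ^κ` with outcomes in the finite set `X`. -/
structure POVM (κ X : Type*) [Fintype κ] [DecidableEq κ] [Fintype X] where
  /-- the operator belonging to each outcome -/
  E : X → Matrix κ κ ℂ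
  posSemidef : ∀ x, (E x).PosSemidef
  sum_eq_one : ∑ x, E x = 1

/-- The probability `⟨v| E_x |v⟩` of the outcome `x` when the state `v` is measured. -/
noncomputable def POVM.prob {κ X : Type*} [Fintype κ] [DecidableEq κ] [Fintype X]
    (M : POVM κ X) (v : κ → ℂ) (x : X) : ℝ :=
  (star v ⬝ᵥ (M.E x *ᵥ v)).re

/-- A `t`-query adaptive quantum algorithm on the space `ℂ^ι`, with outputs in `X`. -/
structure AdaptiveAlgorithm (t : ℕ) (ι X : Type*) [Fintype ι] [DecidableEq ι] [Fintype X] where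
  /-- dimension of the auxiliary workspace -/
  N : ℕ
  /-- initial state, a unit vector of `ℂ^ι ⊗ ℂ^N` -/
  ψ : ι × Fin N → ℂ
  unit_ψ : star ψ ⬝ᵥ ψ = 1
  /-- the unitary operators applied after each query -/
  U : Fin t → Matrix.unitaryGroup (ι × Fin N) ℂ
  /-- the final measurement -/
  M : POVM (ι × Fin N) X

/-- The state `U_t (O ⊗ I) U_{t-1} (O ⊗ I) ⋯ U_1 (O ⊗ I) ψ` before the measurement, where `O` is
the oracle. -/
noncomputable def AdaptiveAlgorithm.finalState {t : ℕ} {ι X : Type*} [Fintype ι] [DecidableEq ι]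
    [Fintype X] (A : AdaptiveAlgorithm t ι X) (O : Matrix.unitaryGroup ι ℂ) :
    ι × Fin A.N → ℂ :=
  Fin.foldl t (fun v k =>
    (A.U k : Matrix (ι × Fin A.N) (ι × Fin A.N) ℂ) *ᵥ
      (((O : Matrix ι ι ℂ) ⊗ₖ (1 : Matrix (Fin A.N) (Fin A.N) ℂ)) *ᵥ v)) A.ψ

/-- The probability that the algorithm outputs `f a`, for `a` uniform in `Y`. -/
noncomputable def AdaptiveAlgorithm.successProb {t : ℕ} {ι X Y : Type*} [Fintype ι]
    [DecidableEq ι] [Fintype X] [Fintype Y] (A : AdaptiveAlgorithm t ι X)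
    (π : Y → Matrix.unitaryGroup ι ℂ) (f : Y → X) : ℝ :=
  (∑ a, A.M.prob (A.finalState (π a)) (f a)) / (Fintype.card Y : ℝ)

/-- The `t`-th tensor power of a matrix, acting on `(ℂ^ι)^{⊗ t}`. -/
def tensorPow {ι : Type*} (t : ℕ) (O : Matrix ι ι ℂ) : Matrix (Fin t → ι) (Fin t → ι) ℂ :=
  Matrix.of fun i j => ∏ k, O (i k) (j k)

/-- A `t`-query nonadaptive (parallel) quantum algorithm on the space `ℂ^ι`, with outputs in
`X`. -/
structure NonadaptiveAlgorithm (t : ℕ) (ι X : Type*) [Fintype ι] [DecidableEq ι]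
    [Fintype X] where
  /-- dimension of the auxiliary register -/
  N : ℕ
  /-- input state, a unit vector of `(ℂ^ι)^{⊗ t} ⊗ ℂ^N` -/
  ψ : (Fin t → ι) × Fin N → ℂ
  unit_ψ : star ψ ⬝ᵥ ψ = 1
  /-- the final measurement -/
  M : POVM ((Fin t → ι) × Fin N) X

/-- The state `(O^{⊗ t} ⊗ I) ψ` before the measurement. -/
noncomputable def NonadaptiveAlgorithm.finalState {t : ℕ} {ι X : Type*} [Fintype ι]
    [DecidableEq ι] [Fintype X] (A : NonadaptiveAlgorithm t ι X)
    (O : Matrix.unitaryGroup ι ℂ) : (Fin t → ι) × Fin A.N → ℂ :=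
  (tensorPow t (O : Matrix ι ι ℂ) ⊗ₖ (1 : Matrix (Fin A.N) (Fin A.N) ℂ)) *ᵥ A.ψ

/-- The probability that the algorithm outputs `f a`, for `a` uniform in `Y`. -/
noncomputable def NonadaptiveAlgorithm.successProb {t : ℕ} {ι X Y : Type*} [Fintype ι]
    [DecidableEq ι] [Fintype X] [Fintype Y] (A : NonadaptiveAlgorithm t ι X)
    (π : Y → Matrix.unitaryGroup ι ℂ) (f : Y → X) : ℝ :=
  (∑ a, A.M.prob (A.finalState (π a)) (f a)) / (Fintype.card Y : ℝ)

/-! ## Permutational oracles -/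

/-- The linearization of a permutation `σ` of `Ω`: the unitary with `|ω⟩ ↦ |σ ω⟩`. -/
def permUnitary {Ω : Type*} [Fintype Ω] [DecidableEq Ω] (σ : Equiv.Perm Ω) :
    Matrix.unitaryGroup Ω ℂ :=
  ⟨Matrix.of fun i j => if i = σ j then 1 else 0, by
    rw [Matrix.mem_unitaryGroup_iff']
    ext i j
    simp [Matrix.mul_apply, Matrix.star_eq_conjTranspose, Matrix.conjTranspose_apply,
      Matrix.one_apply, eq_comm]⟩

/-- A tuple `ω` is a base of the permutation action `π` if only the identity fixes all of its
entries. -/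
def IsBase {G Ω : Type*} [Group G] (π : G →* Equiv.Perm Ω) {t : ℕ} (ω : Fin t → Ω) : Prop :=
  ∀ g : G, (∀ i, π g (ω i) = ω i) ↔ g = 1

end QuantumOracle

/-! ## The Heisenberg group -/

/-- The Heisenberg group `G(p,n)`: the `(n+2) × (n+2)` matrices over `ℤ/p` with ones on the main
diagonal whose only other nonzero entries are in the first row and the last column. -/
def heisenberg (p n : ℕ) [Fact p.Prime] :
    Subgroup (Matrix.GeneralLinearGroup (Fin (n + 2)) (ZMod p)) :=
  let S : Submonoid (Matrix.GeneralLinearGroup (Fin (n + 2)) (ZMod p)) :=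
    { carrier := {A | (∀ i, A i i = 1) ∧
        ∀ i j, i ≠ j → i ≠ 0 → j ≠ Fin.last (n + 1) → A i j = 0}
      one_mem' := by
        refine ⟨fun i => by simp, fun i j hij _ _ => by simp [hij]⟩
      mul_mem' := by
        rintro A B ⟨hA, hA'⟩ ⟨hB, hB'⟩
        have h0 : (0 : Fin (n + 2)) ≠ Fin.last (n + 1) := by simp [Fin.ext_iff]
        have key : ∀ i j, (i = j ∨ (i ≠ 0 ∧ j ≠ Fin.last (n + 1))) →
            (A * B) i j = if i = j then 1 else 0 := by
          intro i j hij
          have : ∀ k, A i k * B k j = if k = i then (if i = j then 1 else 0) else 0 := by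
            intro k
            by_cases hki : k = i
            · subst hki
              by_cases hkj : k = j
              · subst hkj; simp [hA, hB]
              · have := hB' k j hkj; grind
            · have h1 := hA' i k (Ne.symm hki)
              have h2 := hB' k j
              grind
          rw [Matrix.GeneralLinearGroup.coe_mul, Matrix.mul_apply, Finset.sum_congr rfl
            (fun k _ => this k)]
          simp
        exact ⟨fun i => by rw [key i i (Or.inl rfl)]; simp,
          fun i j hij hi hj => by rw [key i j (Or.inr ⟨hi, hj⟩)]; simp [hij]⟩ }
  { S with
    inv_mem' := by
      intro A hA
      have h : A⁻¹ = A ^ (Nat.card (Matrix.GeneralLinearGroup (Fin (n + 2)) (ZMod p)) - 1) := by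
        rw [inv_eq_iff_mul_eq_one, ← pow_succ', Nat.sub_add_cancel Nat.card_pos, pow_card_eq_one']
      rw [h]
      exact S.pow_mem hA _ }

noncomputable instance heisenbergFintype (p n : ℕ) [Fact p.Prime] : Fintype (heisenberg p n) :=
  Fintype.ofFinite _

/-- The action of `G(p,n)` on column vectors in `(ℤ/p)^(n+2)` by matrix-vector multiplication. -/
def heisenbergAction (p n : ℕ) [Fact p.Prime] :
    heisenberg p n →* Equiv.Perm (Fin (n + 2) → ZMod p) where
  toFun A :=
    { toFun := fun v =>
        ((A : Matrix.GeneralLinearGroup (Fin (n + 2)) (ZMod p)) :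
          Matrix (Fin (n + 2)) (Fin (n + 2)) (ZMod p)) *ᵥ v
      invFun := fun v =>
        ((A⁻¹ : Matrix.GeneralLinearGroup (Fin (n + 2)) (ZMod p)) :
          Matrix (Fin (n + 2)) (Fin (n + 2)) (ZMod p)) *ᵥ v
      left_inv := fun v => by
        simp only [Matrix.mulVec_mulVec, ← Matrix.GeneralLinearGroup.coe_mul]; simp
      right_inv := fun v => by
        simp only [Matrix.mulVec_mulVec, ← Matrix.GeneralLinearGroup.coe_mul]; simp }
  map_one' := by ext v; simp
  map_mul' A B := by ext v; simp [Matrix.mulVec_mulVec]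

/-- The quantum oracles: `G(p,n)` acting on `ℂ^X`, for `X = (ℤ/p)^(n+2)`, by permutation
matrices. -/
def heisenbergOracle (p n : ℕ) [Fact p.Prime] (a : heisenberg p n) :
    Matrix.unitaryGroup (Fin (n + 2) → ZMod p) ℂ :=
  QuantumOracle.permUnitary (heisenbergAction p n a)

/-! Let O(g) be the oracle of g = (a, b, c), where a is the first row, b the last column and c the
corner. After one query the state depends linearly on O(g), so all states lie in a space of
dimension at most d = dim span O(G). The guessing probabilities of a POVM on such states sum to at
most d (`sum_prob_le_finrank`), so the success probability is at most d/|G|. Summing over the centre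
gives a relation among oracles for each pair a, b ≠ 0 (`sum_heisAct_relation`), whence d ≤ D =
p^(2n+1) - (p^n - 1)^2.

The bound D/|G| is attained. Let K be the sum of χ(1)χ over the irreducible characters in the
permutation representation. Then K/|G| acts there as the identity (`sum_heisKernel_mul`), and K(1) =
D. A state r with ⟨r, g r⟩ = K(g)/D therefore has a tight orbit with frame constant |G|/D, and the
pretty good measurement (`exists_povm_of_tight_frame`) succeeds with probability D/|G|. Such an r is
a purification of a density matrix ρ with tr(ρ O(g)) = K(g)/D, built by weighting isotypic pieces
(`exists_fibreGram_eq_heisKernel`).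

With two queries, one goes to the vector (0, 0, 1), which reveals b and c; the other uses a state
whose Gram function is the indicator of a = 0. Together they make the orbit orthonormal. -/

namespace QuantumOracle

/-! ### Measurements: pretty good measurement and dimension bound -/

/-- A family of unit vectors that is a tight frame of its span, with frame constant `c`, is
identified with probability `1 / c` by its pretty good measurement. -/
theorem exists_povm_of_tight_frame {κ Y : Type*} [Fintype κ] [DecidableEq κ] [Fintype Y]
    [Nonempty Y] (ψ : Y → κ → ℂ) (c : ℝ) (hc : 0 < c) (hψ : ∀ a, star (ψ a) ⬝ᵥ ψ a = 1)
    (h : ∀ a, ∑ b, (star (ψ b) ⬝ᵥ ψ a) • ψ b = (c : ℂ) • ψ a) :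
    ∃ M : POVM κ Y, ∀ a, M.prob (ψ a) a = 1 / c := by
  classical
  obtain ⟨a₀⟩ := ‹Nonempty Y›
  have hc' : (c : ℂ) ≠ 0 := by exact_mod_cast hc.ne'
  set Q : Y → Matrix κ κ ℂ := fun a => (c : ℂ)⁻¹ • Matrix.vecMulVec (ψ a) (star (ψ a)) with hQ
  set P : Matrix κ κ ℂ := ∑ a, Q a with hP
  have hQpos : ∀ a, (Q a).PosSemidef := fun a =>
    (Matrix.posSemidef_vecMulVec_self_star (ψ a)).smul (by
      rw [← Complex.ofReal_inv]; exact_mod_cast (inv_pos.2 hc).le)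
  have hPψ : ∀ a, P *ᵥ ψ a = ψ a := by
    intro a
    rw [hP, Matrix.sum_mulVec]
    have : ∀ b, Q b *ᵥ ψ a = (c : ℂ)⁻¹ • ((star (ψ b) ⬝ᵥ ψ a) • ψ b) := by
      intro b
      simp only [hQ, Matrix.smul_mulVec, Matrix.vecMulVec_mulVec]
      simp
    simp only [this]
    rw [← Finset.smul_sum, h, smul_smul, inv_mul_cancel₀ hc', one_smul]
  have hPP : P * P = P := by
    conv_lhs => rw [hP, Finset.mul_sum]
    rw [hP]
    refine Finset.sum_congr rfl fun a _ => ?_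
    rw [← hP]
    simp only [hQ, Matrix.mul_smul, Matrix.mul_vecMulVec, hPψ]
  have hPH : Pᴴ = P := by
    rw [hP, Matrix.conjTranspose_sum]
    exact Finset.sum_congr rfl fun a _ => (hQpos a).isHermitian
  have hpos : (1 - P).PosSemidef := by
    have h1 : (1 - P)ᴴ * (1 - P) = 1 - P := by
      rw [Matrix.conjTranspose_sub, hPH, Matrix.conjTranspose_one]
      simp [sub_mul, mul_sub, hPP]
    rw [← h1]
    exact Matrix.posSemidef_conjTranspose_mul_self _
  -- `P` is the projection onto the span of the states. The complement `1 - P` completes the POVM;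
  -- it kills every state, so it may go to any outcome.
  refine ⟨⟨fun a => Q a + if a = a₀ then 1 - P else 0, fun a => ?_, ?_⟩, fun a => ?_⟩
  · split_ifs
    · exact (hQpos a).add hpos
    · simpa using hQpos a
  · rw [Finset.sum_add_distrib, ← hP]
    simp
  · have h2 : (Q a + if a = a₀ then 1 - P else 0) *ᵥ ψ a = (c : ℂ)⁻¹ • ψ a := by
      have h3 : (if a = a₀ then 1 - P else 0) *ᵥ ψ a = 0 := by
        split_ifs
        · rw [Matrix.sub_mulVec, hPψ]; simp
        · simp
      rw [Matrix.add_mulVec, h3]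
      simp only [hQ, Matrix.smul_mulVec, Matrix.vecMulVec_mulVec, hψ]
      simp
    simp only [POVM.prob, h2, dotProduct_smul, hψ]
    rw [← Complex.ofReal_inv]
    simp

/-- Measuring unit vectors of a `d`-dimensional space, the sum of the probabilities of guessing
correctly is at most `d`. -/
theorem sum_prob_le_finrank {κ Y : Type*} [Fintype κ] [DecidableEq κ] [Fintype Y]
    (M : POVM κ Y) (ψ : Y → κ → ℂ) (hψ : ∀ a, star (ψ a) ⬝ᵥ ψ a = 1)
    (W : Submodule ℂ (κ → ℂ)) (hW : ∀ a, ψ a ∈ W) :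
    ∑ a, M.prob (ψ a) a ≤ Module.finrank ℂ W := by
  classical
  let e : (κ → ℂ) ≃ₗ[ℂ] EuclideanSpace ℂ κ := (WithLp.linearEquiv 2 ℂ (κ → ℂ)).symm
  let W' : Submodule ℂ (EuclideanSpace ℂ κ) := W.map e.toLinearMap
  have hfin : Module.finrank ℂ W' = Module.finrank ℂ W := LinearEquiv.finrank_map_eq e W
  let u := stdOrthonormalBasis ℂ W'
  let w : Fin (Module.finrank ℂ W') → κ → ℂ := fun i => ((u i : EuclideanSpace ℂ κ)).ofLp
  have hw : ∀ i, star (w i) ⬝ᵥ w i = 1 := by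
    intro i
    have := u.orthonormal.1 i
    have h2 : inner ℂ (u i : EuclideanSpace ℂ κ) (u i : EuclideanSpace ℂ κ) = 1 := by
      rw [inner_self_eq_norm_sq_to_K]
      have h3 : ‖(u i : EuclideanSpace ℂ κ)‖ = 1 := this
      rw [h3]; simp
    rw [EuclideanSpace.inner_eq_star_dotProduct] at h2
    rw [dotProduct_comm]; exact h2
  -- A unit vector of W gives E_a at most its trace on W, and these traces sum to dim W because the
  -- E_a sum to 1. The comparison is made for each rank-one term of E_a: project its vector to W and
  -- apply Cauchy–Schwarz.
  have key : ∀ a, M.prob (ψ a) a ≤ ∑ i, M.prob (w i) a := by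
    intro a
    have hφ : ‖e (ψ a)‖ = 1 := by
      have h1 : ‖e (ψ a)‖ ^ 2 = 1 := by
        have : (inner ℂ (e (ψ a)) (e (ψ a)) : ℂ) = 1 := by
          rw [EuclideanSpace.inner_eq_star_dotProduct, dotProduct_comm]
          exact hψ a
        rw [inner_self_eq_norm_sq_to_K] at this
        exact Complex.ofReal_injective (by simpa using this)
      nlinarith [norm_nonneg (e (ψ a))]
    obtain ⟨m, v, hv⟩ := Matrix.posSemidef_iff_eq_sum_vecMulVec.mp (M.posSemidef a)
    have hprob : ∀ x : κ → ℂ, M.prob x a = ∑ k, ‖inner ℂ (e (v k)) (e x)‖ ^ 2 := by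
      intro x
      rw [POVM.prob, hv, Matrix.sum_mulVec, dotProduct_sum, Complex.re_sum]
      refine Finset.sum_congr rfl fun k _ => ?_
      have h1 : inner ℂ (e (v k)) (e x) = star (v k) ⬝ᵥ x := by
        rw [EuclideanSpace.inner_eq_star_dotProduct, dotProduct_comm]; rfl
      have h2 : star x ⬝ᵥ v k = star (star (v k) ⬝ᵥ x) := by
        rw [Matrix.star_dotProduct]
      rw [h1, Matrix.vecMulVec_mulVec]
      simp only [op_smul_eq_smul, dotProduct_smul, h2, smul_eq_mul]
      rw [Complex.star_def, Complex.mul_conj, Complex.normSq_eq_norm_sq]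
      exact Complex.ofReal_re _
    rw [hprob]
    simp only [hprob]
    rw [Finset.sum_comm]
    refine Finset.sum_le_sum fun k _ => ?_
    let φ : W' := ⟨e (ψ a), Submodule.mem_map_of_mem (hW a)⟩
    let q : W' := W'.orthogonalProjectionOnto (e (v k))
    have h1 : ∀ x : W', inner ℂ (e (v k)) (x : EuclideanSpace ℂ κ) = inner ℂ q x :=
      fun x => (Submodule.inner_orthogonalProjectionOnto_eq_of_mem_right x (e (v k))).symm
    have h2 : ∀ i, ‖inner ℂ (e (v k)) (e (w i))‖ ^ 2 = ‖inner ℂ q (u i)‖ ^ 2 := fun i => by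
      rw [← h1]; rfl
    have h3 : inner ℂ (e (v k)) (e (ψ a)) = inner ℂ q φ := h1 φ
    simp only [h2, h3]
    rw [u.sum_sq_norm_inner_left]
    have h4 : ‖φ‖ = 1 := hφ
    have h5 := norm_inner_le_norm (𝕜 := ℂ) q φ
    rw [h4, mul_one] at h5
    gcongr
  calc ∑ a, M.prob (ψ a) a ≤ ∑ a, ∑ i, M.prob (w i) a := Finset.sum_le_sum fun a _ => key a
    _ = ∑ i, ∑ a, M.prob (w i) a := Finset.sum_comm
    _ = ∑ i, 1 := by
        refine Finset.sum_congr rfl fun i _ => ?_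
        simp only [POVM.prob]
        rw [← Complex.re_sum, ← dotProduct_sum, ← Matrix.sum_mulVec, M.sum_eq_one,
          Matrix.one_mulVec, hw]
        simp
    _ = Module.finrank ℂ W := by simp [hfin]

end QuantumOracle

namespace QuantumOracle

/-! ### Upper bound for one query -/

theorem star_dotProduct_mulVec_of_mem_unitaryGroup {κ : Type*} [Fintype κ] [DecidableEq κ]
    {U : Matrix κ κ ℂ} (hU : U ∈ Matrix.unitaryGroup κ ℂ) (v : κ → ℂ) :
    star (U *ᵥ v) ⬝ᵥ (U *ᵥ v) = star v ⬝ᵥ v := by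
  rw [Matrix.star_mulVec, ← Matrix.dotProduct_mulVec, Matrix.mulVec_mulVec,
    ← Matrix.star_eq_conjTranspose, Matrix.mem_unitaryGroup_iff'.mp hU, Matrix.one_mulVec]

theorem tensorPow_one_mem_unitaryGroup {ι : Type*} [Fintype ι] [DecidableEq ι]
    (O : Matrix.unitaryGroup ι ℂ) :
    tensorPow 1 (O : Matrix ι ι ℂ) ∈ Matrix.unitaryGroup (Fin 1 → ι) ℂ := by
  rw [Matrix.mem_unitaryGroup_iff']
  have h := Matrix.mem_unitaryGroup_iff'.mp O.2
  have h1 : tensorPow 1 (O : Matrix ι ι ℂ) =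
      (O : Matrix ι ι ℂ).submatrix (Equiv.funUnique (Fin 1) ι) (Equiv.funUnique (Fin 1) ι) := by
    ext i j
    simp [tensorPow]
  rw [h1, Matrix.star_eq_conjTranspose, Matrix.conjTranspose_submatrix,
    Matrix.submatrix_mul_equiv, ← Matrix.star_eq_conjTranspose, h, Matrix.submatrix_one_equiv]

theorem kronecker_one_mem_unitaryGroup {κ μ : Type*} [Fintype κ] [DecidableEq κ] [Fintype μ]
    [DecidableEq μ] {U : Matrix κ κ ℂ} (hU : U ∈ Matrix.unitaryGroup κ ℂ) :
    U ⊗ₖ (1 : Matrix μ μ ℂ) ∈ Matrix.unitaryGroup (κ × μ) ℂ :=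
  Matrix.kronecker_mem_unitary hU (one_mem _)

/-- If the states that an algorithm has to tell apart depend linearly on the oracle, then the sum
of the probabilities of guessing correctly is at most the dimension of the span of the oracles. -/
theorem sum_prob_le_of_linear {κ Y V : Type*} [Fintype κ] [DecidableEq κ] [Fintype Y]
    [AddCommGroup V] [Module ℂ V] [FiniteDimensional ℂ V]
    (M : POVM κ Y) (O : Y → V) (T : V →ₗ[ℂ] (κ → ℂ))
    (hT : ∀ a, star (T (O a)) ⬝ᵥ T (O a) = 1) :
    ∑ a, M.prob (T (O a)) a ≤ Module.finrank ℂ (Submodule.span ℂ (Set.range O)) := by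
  refine (sum_prob_le_finrank M (fun a => T (O a)) hT
    ((Submodule.span ℂ (Set.range O)).map T) fun a =>
      Submodule.mem_map_of_mem (Submodule.subset_span ⟨a, rfl⟩)).trans ?_
  exact_mod_cast Submodule.finrank_map_le T _

theorem AdaptiveAlgorithm.successProb_le {ι Y : Type*} [Fintype ι] [DecidableEq ι] [Fintype Y]
    (A : AdaptiveAlgorithm 1 ι Y) (O : Y → Matrix.unitaryGroup ι ℂ) :
    A.successProb O id ≤
      Module.finrank ℂ (Submodule.span ℂ (Set.range fun a => (O a : Matrix ι ι ℂ))) /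
        (Fintype.card Y : ℝ) := by
  let T : Matrix ι ι ℂ →ₗ[ℂ] (ι × Fin A.N → ℂ) :=
    { toFun := fun X => (A.U 0 : Matrix (ι × Fin A.N) (ι × Fin A.N) ℂ) *ᵥ
        ((X ⊗ₖ (1 : Matrix (Fin A.N) (Fin A.N) ℂ)) *ᵥ A.ψ)
      map_add' := fun X X' => by
        rw [Matrix.add_kronecker, Matrix.add_mulVec, Matrix.mulVec_add]
      map_smul' := fun c X => by
        rw [Matrix.smul_kronecker, Matrix.smul_mulVec, Matrix.mulVec_smul, RingHom.id_apply] }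
  have hT : ∀ a, A.finalState (O a) = T (O a) := fun a => by
    simp [finalState, T, Fin.foldl_succ]
  unfold successProb
  gcongr
  simp only [hT, id]
  refine sum_prob_le_of_linear A.M (fun a => (O a : Matrix ι ι ℂ)) T fun a => ?_
  simp only [T, LinearMap.coe_mk, AddHom.coe_mk]
  rw [star_dotProduct_mulVec_of_mem_unitaryGroup (A.U 0).2,
    star_dotProduct_mulVec_of_mem_unitaryGroup (kronecker_one_mem_unitaryGroup (O a).2), A.unit_ψ]

theorem NonadaptiveAlgorithm.successProb_le {ι Y : Type*} [Fintype ι] [DecidableEq ι] [Fintype Y]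
    (A : NonadaptiveAlgorithm 1 ι Y) (O : Y → Matrix.unitaryGroup ι ℂ) :
    A.successProb O id ≤
      Module.finrank ℂ (Submodule.span ℂ (Set.range fun a => (O a : Matrix ι ι ℂ))) /
        (Fintype.card Y : ℝ) := by
  -- Linearity is special to one query: `tensorPow t` is homogeneous of degree t.
  let T : Matrix ι ι ℂ →ₗ[ℂ] ((Fin 1 → ι) × Fin A.N → ℂ) :=
    { toFun := fun X => (tensorPow 1 X ⊗ₖ (1 : Matrix (Fin A.N) (Fin A.N) ℂ)) *ᵥ A.ψ
      map_add' := fun X X' => by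
        rw [← Matrix.add_mulVec, ← Matrix.add_kronecker]
        congr 2
        ext i j
        simp [tensorPow]
      map_smul' := fun c X => by
        rw [RingHom.id_apply, ← Matrix.smul_mulVec, ← Matrix.smul_kronecker]
        congr 2
        ext i j
        simp [tensorPow] }
  have hT : ∀ a, A.finalState (O a) = T (O a) := fun a => rfl
  unfold successProb
  gcongr
  simp only [hT, id]
  refine sum_prob_le_of_linear A.M (fun a => (O a : Matrix ι ι ℂ)) T fun a => ?_
  simp only [T, LinearMap.coe_mk, AddHom.coe_mk]
  rw [star_dotProduct_mulVec_of_mem_unitaryGroup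
    (kronecker_one_mem_unitaryGroup (tensorPow_one_mem_unitaryGroup (O a))), A.unit_ψ]

/-! ### Algorithms from tight orbits -/

theorem permUnitary_mulVec {Ω : Type*} [Fintype Ω] [DecidableEq Ω] (σ : Equiv.Perm Ω)
    (ψ : Ω → ℂ) : (permUnitary σ : Matrix Ω Ω ℂ) *ᵥ ψ = ψ ∘ σ.symm := by
  ext v
  have h : ∀ w, (v = σ w) = (w = σ.symm v) := fun w => by
    rw [Equiv.eq_symm_apply, eq_comm (a := v)]
  simp [permUnitary, Matrix.mulVec, dotProduct, h]

/-- The permutation action on pairs that is trivial on the second components. -/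
def extendAction {G Ω : Type*} [Group G] (σ : G →* Equiv.Perm Ω) (J : Type*) :
    G →* Equiv.Perm (Ω × J) where
  toFun a := (σ a).prodCongr (Equiv.refl J)
  map_one' := by ext <;> simp
  map_mul' a b := by ext <;> simp

/-- The diagonal permutation action on tuples. -/
def powAction {G Ω : Type*} [Group G] (σ : G →* Equiv.Perm Ω) (t : ℕ) :
    G →* Equiv.Perm (Fin t → Ω) where
  toFun a := Equiv.piCongrRight fun _ => σ a
  map_one' := by ext; simp
  map_mul' a b := by ext; simp

/-- The diagonal permutation action on pairs. -/
def pairAction {G Ω : Type*} [Group G] (σ : G →* Equiv.Perm Ω) : G →* Equiv.Perm (Ω × Ω) where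
  toFun a := (σ a).prodCongr (σ a)
  map_one' := by ext <;> simp
  map_mul' a b := by ext <;> simp

theorem permUnitary_kronecker_one {G Ω J : Type*} [Group G] [Fintype Ω] [DecidableEq Ω]
    [Fintype J] [DecidableEq J] (σ : G →* Equiv.Perm Ω) (a : G) :
    (permUnitary (σ a) : Matrix Ω Ω ℂ) ⊗ₖ (1 : Matrix J J ℂ) = permUnitary (extendAction σ J a) := by
  ext ⟨v, j⟩ ⟨w, k⟩
  simp [permUnitary, extendAction, Matrix.one_apply, ← ite_and, and_comm]

theorem tensorPow_permUnitary {G Ω : Type*} [Group G] [Fintype Ω] [DecidableEq Ω]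
    (σ : G →* Equiv.Perm Ω) (t : ℕ) (a : G) :
    tensorPow t (permUnitary (σ a) : Matrix Ω Ω ℂ) = permUnitary (powAction σ t a) := by
  ext v w
  simp [permUnitary, powAction, tensorPow, Finset.prod_ite_zero, funext_iff]

/-- The translates of the unit vector `r` under a permutation action form a tight frame of their
span, with frame constant `c`. -/
structure IsTightOrbit {G κ : Type*} [Group G] [Fintype G] [Fintype κ] (σ : G →* Equiv.Perm κ)
    (r : κ → ℝ) (c : ℝ) : Prop where
  pos : 0 < c
  norm : ∑ v, r v * r v = 1
  frame : ∀ v, ∑ g, (∑ w, r w * r (σ g w)) * r (σ g v) = c * r v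

theorem IsTightOrbit.comp_equiv {G κ κ' : Type*} [Group G] [Fintype G] [Fintype κ] [Fintype κ']
    {σ : G →* Equiv.Perm κ} {σ' : G →* Equiv.Perm κ'} {r : κ' → ℝ} {c : ℝ}
    (h : IsTightOrbit σ' r c) (e : κ ≃ κ') (he : ∀ g v, e (σ g v) = σ' g (e v)) :
    IsTightOrbit σ (r ∘ e) c where
  pos := h.pos
  norm := by rw [← h.norm]; exact e.sum_comp fun v => r v * r v
  frame v := by
    rw [Function.comp_apply, ← h.frame]
    refine Finset.sum_congr rfl fun g _ => ?_
    simp only [Function.comp_apply, he]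
    rw [e.sum_comp fun w => r w * r (σ' g w)]

theorem star_dotProduct_ofReal {κ : Type*} [Fintype κ] (r s : κ → ℝ) :
    star (fun v => (r v : ℂ)) ⬝ᵥ (fun v => (s v : ℂ)) = ((∑ v, r v * s v : ℝ) : ℂ) := by
  simp [dotProduct]

/-- By equivariance the frame identity at the base vector `r` carries over to every translate. -/
theorem IsTightOrbit.exists_povm {G κ : Type*} [Group G] [Fintype G] [Fintype κ] [DecidableEq κ]
    {σ : G →* Equiv.Perm κ} {r : κ → ℝ} {c : ℝ} (h : IsTightOrbit σ r c) :
    ∃ M : POVM κ G,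
      ∀ a, M.prob ((permUnitary (σ a) : Matrix κ κ ℂ) *ᵥ fun v => (r v : ℂ)) a = 1 / c := by
  have hinv : ∀ a v, (σ a).symm v = σ a⁻¹ v := fun a v => by rw [map_inv]; rfl
  have hψ : ∀ a, ((permUnitary (σ a) : Matrix κ κ ℂ) *ᵥ fun v => (r v : ℂ)) =
      fun v => (r (σ a⁻¹ v) : ℂ) := fun a => by
    rw [permUnitary_mulVec]; ext v; simp only [Function.comp_apply, hinv]
  simp only [hψ]
  refine exists_povm_of_tight_frame _ c h.pos (fun a => ?_) fun a => ?_
  · rw [star_dotProduct_ofReal, Equiv.sum_comp (σ a⁻¹) fun v => r v * r v, h.norm, Complex.ofReal_one]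
  · ext v
    simp only [star_dotProduct_ofReal, Finset.sum_apply, Pi.smul_apply, smul_eq_mul]
    norm_cast
    -- The substitution b = a g⁻¹ moves the sum for the translate by a to the one at `r`.
    rw [← h.frame, ← Equiv.sum_comp ((Equiv.inv G).trans (Equiv.mulLeft a))]
    refine Finset.sum_congr rfl fun g _ => ?_
    simp only [Equiv.trans_apply, Equiv.coe_mulLeft, Equiv.inv_apply, mul_inv_rev, inv_inv,
      map_mul, Equiv.Perm.mul_apply]
    congr 1
    rw [← Equiv.sum_comp (σ a⁻¹) fun w => r w * r (σ g w)]
    exact Finset.sum_congr rfl fun w _ => mul_comm _ _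

theorem sum_div_card_of_forall_eq {G : Type*} [Fintype G] [Nonempty G] {c : ℝ} {f : G → ℝ}
    (h : ∀ a, f a = 1 / c) :
    (∑ a, f a) / (Fintype.card G : ℝ) = 1 / c := by
  have : (Fintype.card G : ℝ) ≠ 0 := by exact_mod_cast Fintype.card_ne_zero
  simp only [h, Finset.sum_const, Finset.card_univ, nsmul_eq_mul]
  field_simp

variable {G Ω J : Type*} [Group G] [Fintype G] [Fintype Ω] [DecidableEq Ω] [Fintype J]
  {σ : G →* Equiv.Perm Ω} {c : ℝ}

theorem IsTightOrbit.exists_nonadaptiveAlgorithm {t : ℕ} {r : (Fin t → Ω) × J → ℝ}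
    (h : IsTightOrbit (extendAction (powAction σ t) J) r c) :
    ∃ A : NonadaptiveAlgorithm t Ω G,
      A.successProb (fun a => permUnitary (σ a)) id = 1 / c := by
  have h' := h.comp_equiv (σ := extendAction (powAction σ t) (Fin (Fintype.card J)))
    (Equiv.prodCongr (Equiv.refl _) (Fintype.equivFin J).symm) (fun g v => rfl)
  obtain ⟨M, hM⟩ := h'.exists_povm
  refine ⟨⟨_, fun v => ((r ∘ (Equiv.prodCongr (Equiv.refl _) (Fintype.equivFin J).symm)) v : ℝ),
    ?_, M⟩, sum_div_card_of_forall_eq fun a => ?_⟩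
  · rw [star_dotProduct_ofReal, h'.norm, Complex.ofReal_one]
  · rw [← hM]
    simp only [NonadaptiveAlgorithm.finalState, id]
    rw [tensorPow_permUnitary, permUnitary_kronecker_one]

theorem IsTightOrbit.exists_nonadaptiveAlgorithm_one {r : Ω × J → ℝ}
    (h : IsTightOrbit (extendAction σ J) r c) :
    ∃ A : NonadaptiveAlgorithm 1 Ω G,
      A.successProb (fun a => permUnitary (σ a)) id = 1 / c :=
  (h.comp_equiv (σ := extendAction (powAction σ 1) J)
    (Equiv.prodCongr (Equiv.funUnique (Fin 1) Ω) (Equiv.refl J))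
    fun _ _ => rfl).exists_nonadaptiveAlgorithm

theorem IsTightOrbit.exists_nonadaptiveAlgorithm_two {r : (Ω × Ω) × J → ℝ}
    (h : IsTightOrbit (extendAction (pairAction σ) J) r c) :
    ∃ A : NonadaptiveAlgorithm 2 Ω G,
      A.successProb (fun a => permUnitary (σ a)) id = 1 / c :=
  (h.comp_equiv (σ := extendAction (powAction σ 2) J)
    (Equiv.prodCongr (finTwoArrowEquiv Ω) (Equiv.refl J))
    fun _ _ => rfl).exists_nonadaptiveAlgorithm

theorem IsTightOrbit.exists_adaptiveAlgorithm_one {r : Ω × J → ℝ}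
    (h : IsTightOrbit (extendAction σ J) r c) :
    ∃ A : AdaptiveAlgorithm 1 Ω G,
      A.successProb (fun a => permUnitary (σ a)) id = 1 / c := by
  have h' := h.comp_equiv (σ := extendAction σ (Fin (Fintype.card J)))
    (Equiv.prodCongr (Equiv.refl _) (Fintype.equivFin J).symm) (fun g v => rfl)
  obtain ⟨M, hM⟩ := h'.exists_povm
  refine ⟨⟨_, fun v => ((r ∘ (Equiv.prodCongr (Equiv.refl _) (Fintype.equivFin J).symm)) v : ℝ),
    ?_, fun _ => 1, M⟩, sum_div_card_of_forall_eq fun a => ?_⟩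
  · rw [star_dotProduct_ofReal, h'.norm, Complex.ofReal_one]
  · rw [← hM]
    simp only [AdaptiveAlgorithm.finalState, id, Fin.foldl_succ, Fin.foldl_zero]
    rw [permUnitary_kronecker_one, Matrix.UnitaryGroup.one_val, Matrix.one_mulVec]

/-- Two parallel queries are simulated by two successive ones: the second argument of the query
is kept in the workspace and exchanged with the first one after each query. -/
theorem IsTightOrbit.exists_adaptiveAlgorithm_two {r : (Ω × Ω) × J → ℝ}
    (h : IsTightOrbit (extendAction (pairAction σ) J) r c) :
    ∃ A : AdaptiveAlgorithm 2 Ω G,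
      A.successProb (fun a => permUnitary (σ a)) id = 1 / c := by
  let f : Ω × J ≃ Fin (Fintype.card (Ω × J)) := Fintype.equivFin (Ω × J)
  let e : Ω × Fin (Fintype.card (Ω × J)) ≃ (Ω × Ω) × J :=
    (Equiv.prodCongr (Equiv.refl Ω) f.symm).trans (Equiv.prodAssoc Ω Ω J).symm
  let s : Equiv.Perm (Ω × Fin (Fintype.card (Ω × J))) :=
    (e.trans (Equiv.prodCongr (Equiv.prodComm Ω Ω) (Equiv.refl J))).trans e.symm
  let τ : G →* Equiv.Perm (Ω × Fin (Fintype.card (Ω × J))) :=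
    e.symm.permCongrHom.toMonoidHom.comp (extendAction (pairAction σ) J)
  have hτ : ∀ a v, e (τ a v) = extendAction (pairAction σ) J a (e v) := fun a v => by
    simp [τ, Equiv.permCongrHom, Equiv.permCongr_apply]
  -- Two rounds of query and swap act on each argument once and restore their order.
  have hs : ∀ a v, s (extendAction σ _ a (s (extendAction σ _ a v))) = τ a v := fun a v => by
    apply e.injective
    rw [hτ]
    simp [s, e, extendAction, pairAction]
  have h' := h.comp_equiv (σ := τ) e hτ
  obtain ⟨M, hM⟩ := h'.exists_povm
  refine ⟨⟨_, fun v => ((r ∘ e) v : ℝ), ?_, fun _ => permUnitary s, M⟩,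
    sum_div_card_of_forall_eq fun a => ?_⟩
  · rw [star_dotProduct_ofReal, h'.norm, Complex.ofReal_one]
  · rw [← hM]
    simp only [AdaptiveAlgorithm.finalState, id, Fin.foldl_succ, Fin.foldl_zero]
    rw [permUnitary_kronecker_one]
    simp only [permUnitary_mulVec]
    have hinv : ∀ v, (τ a).symm v =
        (extendAction σ _ a).symm (s.symm ((extendAction σ _ a).symm (s.symm v))) := fun v => by
      rw [Equiv.symm_apply_eq, ← hs]
      simp
    congr 1
    ext v
    simp only [Function.comp_apply, hinv]

end QuantumOracle

section Heisenberg

/-! ### Coordinates on the Heisenberg group -/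

/-- A vector split into its first coordinate, its middle coordinates and its last coordinate. -/
def vecEquiv (p n : ℕ) : (Fin (n + 2) → ZMod p) ≃ ZMod p × (Fin n → ZMod p) × ZMod p where
  toFun v := (v 0, fun i => v i.castSucc.succ, v (Fin.last (n + 1)))
  invFun w := Fin.cons w.1 (Fin.snoc (α := fun _ => ZMod p) w.2.1 w.2.2 : Fin (n + 1) → ZMod p)
  left_inv v := by
    ext j
    refine Fin.cases rfl (fun j => ?_) j
    refine Fin.lastCases ?_ (fun i => ?_) j <;> simp
  right_inv w := by
    simp only [Fin.cons_zero, Fin.cons_succ, ← Fin.succ_last, Fin.snoc_last, Fin.snoc_castSucc]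

/-- The action of the Heisenberg group in coordinates. -/
def heisAct {p n : ℕ} (g : (Fin n → ZMod p) × (Fin n → ZMod p) × ZMod p)
    (v : ZMod p × (Fin n → ZMod p) × ZMod p) : ZMod p × (Fin n → ZMod p) × ZMod p :=
  (v.1 + g.1 ⬝ᵥ v.2.1 + g.2.2 * v.2.2, v.2.1 + v.2.2 • g.2.1, v.2.2)

variable {p n : ℕ}

theorem vecEquiv_symm_mid (w : ZMod p × (Fin n → ZMod p) × ZMod p) (i : Fin n) :
    (vecEquiv p n).symm w i.castSucc.succ = w.2.1 i :=
  congrFun (congrArg (fun u => u.2.1) ((vecEquiv p n).apply_symm_apply w)) i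

theorem vecEquiv_symm_last (w : ZMod p × (Fin n → ZMod p) × ZMod p) :
    (vecEquiv p n).symm w (Fin.last (n + 1)) = w.2.2 :=
  congrArg (fun u => u.2.2) ((vecEquiv p n).apply_symm_apply w)

theorem Fin.mid_ne_zero (i : Fin n) : i.castSucc.succ ≠ 0 := by simp [Fin.ext_iff]

theorem Fin.mid_ne_last (i : Fin n) : i.castSucc.succ ≠ Fin.last (n + 1) := by
  simp [Fin.ext_iff]; omega

theorem Fin.zero_ne_last_succ : (0 : Fin (n + 2)) ≠ Fin.last (n + 1) := by simp [Fin.ext_iff]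

theorem Fin.zero_or_last_or_mid (j : Fin (n + 2)) :
    j = 0 ∨ j = Fin.last (n + 1) ∨ ∃ i : Fin n, j = i.castSucc.succ := by
  refine Fin.cases (by simp) (fun j => ?_) j
  refine Fin.lastCases (by simp) (fun i => ?_) j
  exact Or.inr (Or.inr ⟨i, rfl⟩)

variable [Fact p.Prime]

theorem mem_heisenberg {A : Matrix.GeneralLinearGroup (Fin (n + 2)) (ZMod p)} :
    A ∈ heisenberg p n ↔ (∀ i, A i i = 1) ∧
      ∀ i j, i ≠ j → i ≠ 0 → j ≠ Fin.last (n + 1) → A i j = 0 := Iff.rfl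

/-- The matrix with given entries in the first row and the last column. -/
def heisMatrix (g : (Fin n → ZMod p) × (Fin n → ZMod p) × ZMod p) :
    Matrix (Fin (n + 2)) (Fin (n + 2)) (ZMod p) := fun i j =>
  if i = j then 1
  -- The entries 1 here, and `g.2.2` and 1 on the next line, are padding: earlier branches exclude
  -- the positions where they would be read.
  else if i = 0 then (vecEquiv p n).symm (1, g.1, g.2.2) j
  else if j = Fin.last (n + 1) then (vecEquiv p n).symm (g.2.2, g.2.1, 1) i
  else 0

theorem heisMatrix_det (g : (Fin n → ZMod p) × (Fin n → ZMod p) × ZMod p) :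
    (heisMatrix g).det = 1 := by
  rw [Matrix.det_of_isUpperTriangular]
  · simp [heisMatrix]
  · intro i j hij
    have hij : j < i := hij
    have h0 : i ≠ 0 := by rintro rfl; simp at hij
    have h1 : j ≠ Fin.last (n + 1) := by
      rintro rfl; exact absurd hij (not_lt.2 (Fin.le_last i))
    simp [heisMatrix, hij.ne', h0, h1]

/-- The entries in the first row and the last column as coordinates on the Heisenberg group. -/
noncomputable def heisEquiv (p n : ℕ) [Fact p.Prime] :
    heisenberg p n ≃ (Fin n → ZMod p) × (Fin n → ZMod p) × ZMod p where
  toFun A := (fun i => A.1 0 i.castSucc.succ, fun i => A.1 i.castSucc.succ (Fin.last (n + 1)),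
    A.1 0 (Fin.last (n + 1)))
  invFun g := ⟨Matrix.GeneralLinearGroup.mkOfDetNeZero (heisMatrix g)
      (by rw [heisMatrix_det]; exact one_ne_zero), by
    rw [mem_heisenberg]
    refine ⟨fun i => ?_, fun i j hij hi hj => ?_⟩
    · change heisMatrix g i i = 1
      simp [heisMatrix]
    · change heisMatrix g i j = 0
      simp [heisMatrix, hij, hi, hj]⟩
  left_inv A := by
    obtain ⟨h1, h2⟩ := mem_heisenberg.1 A.2
    apply Subtype.ext
    apply Units.ext
    ext i j
    change heisMatrix _ i j = A.1 i j
    by_cases hij : i = j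
    · subst hij; rw [h1]; simp [heisMatrix]
    by_cases hi : i = 0
    · subst hi
      rcases Fin.zero_or_last_or_mid j with rfl | rfl | ⟨k, rfl⟩
      · exact absurd rfl hij
      · simp [heisMatrix, hij, vecEquiv_symm_last]
      · simp [heisMatrix, hij, vecEquiv_symm_mid]
    by_cases hj : j = Fin.last (n + 1)
    · subst hj
      rcases Fin.zero_or_last_or_mid i with rfl | rfl | ⟨k, rfl⟩
      · exact absurd rfl hi
      · exact absurd rfl hij
      · simp [heisMatrix, hij, hi, vecEquiv_symm_mid]
    · rw [h2 i j hij hi hj]; simp [heisMatrix, hij, hi, hj]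
  right_inv g := by
    refine Prod.ext (funext fun i => ?_) (Prod.ext (funext fun i => ?_) ?_)
    · change heisMatrix g 0 i.castSucc.succ = _
      simp [heisMatrix, (Fin.mid_ne_zero i).symm, vecEquiv_symm_mid]
    · change heisMatrix g i.castSucc.succ (Fin.last (n + 1)) = _
      simp [heisMatrix, Fin.mid_ne_last i, vecEquiv_symm_mid]
    · change heisMatrix g 0 (Fin.last (n + 1)) = _
      simp [heisMatrix, vecEquiv_symm_last]

theorem Fin.sum_univ_zero_mid_last {M : Type*} [AddCommMonoid M] (f : Fin (n + 2) → M) :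
    ∑ j, f j = f 0 + ∑ i : Fin n, f i.castSucc.succ + f (Fin.last (n + 1)) := by
  rw [Fin.sum_univ_succ, Fin.sum_univ_castSucc, ← add_assoc, Fin.succ_last]

theorem vecEquiv_heisenbergAction (A : heisenberg p n) (v : Fin (n + 2) → ZMod p) :
    vecEquiv p n (heisenbergAction p n A v) = heisAct (heisEquiv p n A) (vecEquiv p n v) := by
  obtain ⟨h1, h2⟩ := mem_heisenberg.1 A.2
  have hv : ∀ i, heisenbergAction p n A v i = ∑ j, A.1 i j * v j := fun i => rfl
  have hl : ∀ j, j ≠ Fin.last (n + 1) → A.1 (Fin.last (n + 1)) j = 0 := fun j hj =>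
    h2 _ _ hj.symm Fin.zero_ne_last_succ.symm hj
  refine Prod.ext ?_ (Prod.ext (funext fun i => ?_) ?_)
  · change heisenbergAction p n A v 0 = _
    rw [hv, Fin.sum_univ_zero_mid_last, h1]
    simp [heisAct, heisEquiv, vecEquiv, dotProduct]
  · change heisenbergAction p n A v i.castSucc.succ = _
    rw [hv, Fin.sum_univ_zero_mid_last, h2 _ 0 (Fin.mid_ne_zero i) (Fin.mid_ne_zero i)
      Fin.zero_ne_last_succ, Finset.sum_eq_single i, h1]
    · simp [heisAct, heisEquiv, vecEquiv, mul_comm]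
    · intro j _ hj
      rw [h2 _ _ (by simpa [Fin.ext_iff, eq_comm] using hj) (Fin.mid_ne_zero i)
        (Fin.mid_ne_last j), zero_mul]
    · simp
  · change heisenbergAction p n A v (Fin.last (n + 1)) = _
    rw [hv, Finset.sum_eq_single (Fin.last (n + 1)), h1]
    · simp [heisAct, vecEquiv]
    · intro j _ hj
      rw [hl j hj, zero_mul]
    · simp

theorem heisEquiv_eq_zero_iff (A : heisenberg p n) : heisEquiv p n A = 0 ↔ A = 1 := by
  rw [← (heisEquiv p n).injective.eq_iff]
  suffices h : heisEquiv p n 1 = 0 by rw [h]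
  refine Prod.ext (funext fun i => ?_) (Prod.ext (funext fun i => ?_) ?_)
  · exact Matrix.one_apply_ne (Fin.mid_ne_zero i).symm
  · exact Matrix.one_apply_ne (Fin.mid_ne_last i)
  · exact Matrix.one_apply_ne Fin.zero_ne_last_succ

theorem card_heisenberg : Fintype.card (heisenberg p n) = p ^ (2 * n + 1) := by
  rw [Fintype.card_congr (heisEquiv p n)]
  simp [ZMod.card]
  ring

theorem heisenbergAction_eq_self_iff (A : heisenberg p n) (v : Fin (n + 2) → ZMod p) :
    heisenbergAction p n A v = v ↔ heisAct (heisEquiv p n A) (vecEquiv p n v) = vecEquiv p n v := by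
  rw [← (vecEquiv p n).injective.eq_iff, vecEquiv_heisenbergAction]

/-! ### The base size -/

/-- The last basis vector detects b and c, and the i-th middle one detects the i-th entry of a. -/
theorem exists_isBase_heisenbergAction :
    ∃ ω : Fin (n + 1) → (Fin (n + 2) → ZMod p),
      QuantumOracle.IsBase (heisenbergAction p n) ω := by
  refine ⟨fun k => (vecEquiv p n).symm
    (Fin.lastCases (motive := fun _ => ZMod p × (Fin n → ZMod p) × ZMod p) (0, 0, 1)
      (fun i => (0, Pi.single i 1, 0)) k), fun A => ⟨fun h => ?_, fun h => by simp [h]⟩⟩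
  rw [← heisEquiv_eq_zero_iff]
  simp only [heisenbergAction_eq_self_iff, Equiv.apply_symm_apply] at h
  generalize heisEquiv p n A = g at h ⊢
  obtain ⟨a, b, c⟩ := g
  have hl := h (Fin.last n)
  simp only [Fin.lastCases_last, heisAct, Prod.mk.injEq] at hl
  have ha : a = 0 := by
    ext i
    have := h i.castSucc
    simp only [Fin.lastCases_castSucc, heisAct, Prod.mk.injEq] at this
    simpa using this.1
  have hb : b = 0 := by simpa using hl.2.1
  have hc : c = 0 := by simpa using hl.1
  simp [ha, hb, hc]

/-- An element with b = 0 fixes (x, y, z) exactly when a·y + cz = 0. These are t linear equations in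
the n + 1 unknowns (a, c), with a nonzero solution if t ≤ n. -/
theorem succ_le_of_isBase_heisenbergAction {t : ℕ} {ω : Fin t → (Fin (n + 2) → ZMod p)}
    (h : QuantumOracle.IsBase (heisenbergAction p n) ω) : n + 1 ≤ t := by
  by_contra! ht
  let T : ((Fin n → ZMod p) × ZMod p) →ₗ[ZMod p] (Fin t → ZMod p) :=
    { toFun := fun u k => u.1 ⬝ᵥ (vecEquiv p n (ω k)).2.1 + u.2 * (vecEquiv p n (ω k)).2.2
      map_add' := fun u u' => by ext k; simp [add_dotProduct]; ring
      map_smul' := fun r u => by ext k; simp [smul_dotProduct]; ring }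
  obtain ⟨u, hu, hu0⟩ := (Submodule.ne_bot_iff _).1
    (LinearMap.ker_ne_bot_of_finrank_lt (f := T) (by simpa using ht))
  have h1 := (h ((heisEquiv p n).symm (u.1, 0, u.2))).1 fun k => by
    rw [heisenbergAction_eq_self_iff, Equiv.apply_symm_apply]
    have := congrFun (LinearMap.mem_ker.1 hu) k
    simp only [T, LinearMap.coe_mk, AddHom.coe_mk, Pi.zero_apply] at this
    simp [heisAct, add_assoc, this]
  rw [← heisEquiv_eq_zero_iff, Equiv.apply_symm_apply] at h1
  simp only [Prod.mk_eq_zero] at h1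
  exact hu0 (Prod.ext h1.1 h1.2.2)

/-! ### Sums over the Heisenberg group -/

theorem sum_add_mul_eq {M : Type*} [AddCommMonoid M] (f : ZMod p → M) (x : ZMod p) {z : ZMod p}
    (hz : z ≠ 0) : ∑ c, f (x + c * z) = ∑ c, f c :=
  Equiv.sum_comp ((Equiv.mulRight₀ z hz).trans (Equiv.addLeft x)) f

theorem sum_add_smul_eq {M : Type*} [AddCommMonoid M] (f : (Fin n → ZMod p) → M)
    (y : Fin n → ZMod p) {z : ZMod p} (hz : z ≠ 0) : ∑ b, f (y + z • b) = ∑ b, f b := by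
  refine Fintype.sum_bijective (fun b => y + z • b) ?_ _ _ fun _ => rfl
  exact (AddGroup.addLeft_bijective y).comp (MulAction.bijective₀ hz)

/-- For a ≠ 0 the values a·y are equidistributed, since shifting y along one coordinate shifts a·y
arbitrarily. The factor p avoids the exponent n - 1. -/
theorem prime_mul_sum_dotProduct (f : ZMod p → ℝ) {a : Fin n → ZMod p} (ha : a ≠ 0) :
    (p : ℝ) * ∑ y, f (a ⬝ᵥ y) = (p : ℝ) ^ n * ∑ x, f x := by
  obtain ⟨i, hi⟩ := Function.ne_iff.1 ha
  have h1 : ∀ x, ∑ y, f (a ⬝ᵥ y + x) = ∑ y, f (a ⬝ᵥ y) := fun x => by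
    rw [← Equiv.sum_comp (Equiv.addRight (Pi.single i ((a i)⁻¹ * x))) fun y => f (a ⬝ᵥ y)]
    refine Finset.sum_congr rfl fun y _ => ?_
    rw [Equiv.coe_addRight, dotProduct_add, dotProduct_single, mul_inv_cancel_left₀ hi]
  calc (p : ℝ) * ∑ y, f (a ⬝ᵥ y) = ∑ x : ZMod p, ∑ y, f (a ⬝ᵥ y + x) := by
        simp [h1, ZMod.card]
    _ = ∑ y : Fin n → ZMod p, ∑ x, f (a ⬝ᵥ y + x) := Finset.sum_comm
    _ = ∑ y : Fin n → ZMod p, ∑ x, f x :=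
        Finset.sum_congr rfl fun y _ => Equiv.sum_comp (Equiv.addLeft (a ⬝ᵥ y)) f
    _ = (p : ℝ) ^ n * ∑ x, f x := by simp [ZMod.card]

/-- On vectors with z = 0 only a acts; for z ≠ 0 the sum over c absorbs the shift by a, leaving only
b. In either case the two sides agree term by term, up to order. -/
theorem sum_heisAct_relation {M : Type*} [AddCommMonoid M]
    (f : ZMod p × (Fin n → ZMod p) × ZMod p → M) (a b : Fin n → ZMod p)
    (v : ZMod p × (Fin n → ZMod p) × ZMod p) :
    ∑ c, f (heisAct (a, b, c) v) + ∑ c, f (heisAct (0, 0, c) v) =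
      ∑ c, f (heisAct (a, 0, c) v) + ∑ c, f (heisAct (0, b, c) v) := by
  obtain ⟨x, y, z⟩ := v
  by_cases hz : z = 0
  · simp [heisAct, hz]
  · simp only [heisAct]
    rw [sum_add_mul_eq (fun u => f (u, y + z • b, z)) _ hz,
      sum_add_mul_eq (fun u => f (u, y + z • (0 : Fin n → ZMod p), z)) _ hz,
      sum_add_mul_eq (fun u => f (u, y + z • b, z)) _ hz,
      sum_add_mul_eq (fun u => f (u, y + z • (0 : Fin n → ZMod p), z)) _ hz, add_comm]

/-- The sum of `χ(1) χ` over the irreducible characters `χ` of the Heisenberg group that occur in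
its action on vectors. -/
noncomputable def heisKernel (g : (Fin n → ZMod p) × (Fin n → ZMod p) × ZMod p) : ℝ :=
  (if g.1 = 0 ∧ g.2.1 = 0 then (p : ℝ) ^ (2 * n) * ((if g.2.2 = 0 then (p : ℝ) else 0) - 1) else 0)
    + (if g.1 = 0 then (p : ℝ) ^ n else 0) + (if g.2.1 = 0 then (p : ℝ) ^ n else 0) - 1

/-- `heisKernel` divided by |G| is the sum of the central idempotents of the irreducibles that
occur, so it acts as the identity. The proof checks this directly for z = 0 and z ≠ 0. -/
theorem sum_heisKernel_mul (f : ZMod p × (Fin n → ZMod p) × ZMod p → ℝ)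
    (v : ZMod p × (Fin n → ZMod p) × ZMod p) :
    ∑ g, heisKernel g * f (heisAct g v) = (p : ℝ) ^ (2 * n + 1) * f v := by
  have h : ∑ g, heisKernel g * f (heisAct g v) =
      (p : ℝ) ^ (2 * n) * (p * f (heisAct 0 v) - ∑ c, f (heisAct (0, 0, c) v))
      + (p : ℝ) ^ n * ∑ b, ∑ c, f (heisAct (0, b, c) v)
      + (p : ℝ) ^ n * ∑ a, ∑ c, f (heisAct (a, 0, c) v)
      - ∑ a, ∑ b, ∑ c, f (heisAct (a, b, c) v) := by
    simp only [heisKernel, add_mul, sub_mul, Finset.sum_add_distrib, Finset.sum_sub_distrib,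
      Fintype.sum_prod_type, one_mul]
    congr 1
    congr 1
    · congr 1
      · have : ∀ a b : Fin n → ZMod p, ∀ c, (if a = 0 ∧ b = 0 then (p : ℝ) ^ (2 * n) *
            ((if c = 0 then (p : ℝ) else 0) - 1) else 0) * f (heisAct (a, b, c) v) =
            if a = 0 then (if b = 0 then (p : ℝ) ^ (2 * n) *
              ((if c = 0 then (p : ℝ) * f (heisAct 0 v) else 0) - f (heisAct (0, 0, c) v))
                else 0) else 0 := by
          intro a b c
          by_cases ha : a = 0 <;> by_cases hb : b = 0 <;> by_cases hc : c = 0 <;>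
            simp [ha, hb, hc]
          simp only [← Prod.zero_eq_mk]
          ring
        simp only [this]
        simp [Finset.sum_ite_irrel, ← Finset.mul_sum]
      · simp [ite_mul, Finset.sum_ite_irrel, ← Finset.mul_sum]
    · simp [ite_mul, Finset.sum_ite_irrel, ← Finset.mul_sum]
  rw [h]
  obtain ⟨x, y, z⟩ := v
  have h0 : f (heisAct 0 (x, y, z)) = f (x, y, z) := by simp [heisAct]
  rw [h0]
  by_cases hz : z = 0
  · subst hz
    simp only [heisAct, mul_zero, zero_smul, add_zero, zero_dotProduct, Finset.sum_const,
      Finset.card_univ, ZMod.card, Fintype.card_pi, Finset.prod_const, Fintype.card_fin,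
      nsmul_eq_mul, ← Finset.mul_sum]
    push_cast
    ring
  · simp only [heisAct]
    simp only [fun (u : ZMod p) (w : Fin n → ZMod p) =>
      sum_add_mul_eq (fun c => f (c, w, z)) u hz]
    simp only [fun w : Fin n → ZMod p => sum_add_smul_eq (fun w => ∑ c, f (c, w, z)) w hz]
    simp only [smul_zero, add_zero, Finset.sum_const,
      Finset.card_univ, ZMod.card, Fintype.card_pi, Finset.prod_const, Fintype.card_fin,
      nsmul_eq_mul]
    push_cast
    ring

/-! ### The Gram function of a state -/

/-- The amplitude at `v` and `w` of the state whose reduced state is, on each fibre `(·, y, z)`,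
`s (y, z) ^ 2` on the functions of sum zero and `t (y, z) ^ 2` on the constants. -/
noncomputable def fibreAmp (s t : (Fin n → ZMod p) × ZMod p → ℝ)
    (v w : ZMod p × (Fin n → ZMod p) × ZMod p) : ℝ :=
  if v.2 = w.2 then s v.2 * ((if v.1 = w.1 then 1 else 0) - (p : ℝ)⁻¹) + t v.2 * (p : ℝ)⁻¹ else 0

/-- With J the all-ones matrix, 1 - J/p and J/p are complementary projections, so squaring their
combination squares the coefficients. -/
theorem sum_fibre_mul_fibre (s t : ℝ) (x x' : ZMod p) :
    ∑ u, (s * ((if x = u then 1 else 0) - (p : ℝ)⁻¹) + t * (p : ℝ)⁻¹) *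
      (s * ((if x' = u then 1 else 0) - (p : ℝ)⁻¹) + t * (p : ℝ)⁻¹) =
    s ^ 2 * ((if x' = x then 1 else 0) - (p : ℝ)⁻¹) + t ^ 2 * (p : ℝ)⁻¹ := by
  have hp : (p : ℝ) ≠ 0 := by exact_mod_cast (Fact.out : p.Prime).ne_zero
  have h : ∀ u, (s * ((if x = u then 1 else 0) - (p : ℝ)⁻¹) + t * (p : ℝ)⁻¹) *
      (s * ((if x' = u then 1 else 0) - (p : ℝ)⁻¹) + t * (p : ℝ)⁻¹) =
      (if x = u then s ^ 2 * (if x' = x then 1 else 0) + s * (t - s) * (p : ℝ)⁻¹ else 0)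
      + (if x' = u then s * (t - s) * (p : ℝ)⁻¹ else 0) + ((t - s) * (p : ℝ)⁻¹) ^ 2 := by
    intro u
    by_cases h1 : x = u
    · subst h1
      by_cases h2 : x' = x <;> simp [h2] <;> ring
    · simp only [h1, if_false]
      split_ifs <;> ring
  simp only [h, Finset.sum_add_distrib, Finset.sum_ite_eq, Finset.mem_univ, if_true,
    Finset.sum_const, Finset.card_univ, ZMod.card, nsmul_eq_mul]
  field_simp
  ring

/-- This is tr(ρ O(g)). Only fibres mapped to themselves (z b = 0) contribute. There g translates x
by a·y + cz, with trace p or 0, less 1, on functions of sum zero, and 1 on constants. -/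
theorem sum_fibreAmp_mul (s t : (Fin n → ZMod p) × ZMod p → ℝ)
    (g : (Fin n → ZMod p) × (Fin n → ZMod p) × ZMod p) :
    ∑ v, ∑ w, fibreAmp s t v w * fibreAmp s t (heisAct g v) w =
      ∑ u : (Fin n → ZMod p) × ZMod p, if u.2 • g.2.1 = 0 then
        s u ^ 2 * ((if g.1 ⬝ᵥ u.1 + g.2.2 * u.2 = 0 then (p : ℝ) else 0) - 1) + t u ^ 2
      else 0 := by
  have hp : (p : ℝ) ≠ 0 := by exact_mod_cast (Fact.out : p.Prime).ne_zero
  have h : ∀ x u, ∑ w, fibreAmp s t (x, u) w * fibreAmp s t (heisAct g (x, u)) w =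
      if u.2 • g.2.1 = 0 then
        s u ^ 2 * ((if g.1 ⬝ᵥ u.1 + g.2.2 * u.2 = 0 then 1 else 0) - (p : ℝ)⁻¹)
          + t u ^ 2 * (p : ℝ)⁻¹ else 0 := by
    intro x u
    rw [Fintype.sum_prod_type, Finset.sum_comm, Finset.sum_eq_single u]
    · have hu : (heisAct g (x, u)).2 = u ↔ u.2 • g.2.1 = 0 := by
        simp [heisAct, Prod.ext_iff]
      by_cases hb : u.2 • g.2.1 = 0
      · simp only [fibreAmp, hu.2 hb, if_true, hb]
        rw [sum_fibre_mul_fibre]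
        have : (heisAct g (x, u)).1 = x ↔ g.1 ⬝ᵥ u.1 + g.2.2 * u.2 = 0 := by
          simp [heisAct, add_assoc]
        simp only [this]
      · simp [fibreAmp, hu, hb]
    · intro u' _ hu'
      simp [fibreAmp, hu'.symm]
    · simp
  rw [Fintype.sum_prod_type, Finset.sum_comm]
  simp only [h, Finset.sum_const, Finset.card_univ, ZMod.card, nsmul_eq_mul]
  refine Finset.sum_congr rfl fun u _ => ?_
  split_ifs <;> field_simp <;> ring

theorem prime_mul_card_dotProduct_eq (a : Fin n → ZMod p) (c : ZMod p) :
    ∑ y : Fin n → ZMod p, (if a ⬝ᵥ y + c = 0 then (p : ℝ) else 0) =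
      if a = 0 then (if c = 0 then (p : ℝ) ^ (n + 1) else 0) else (p : ℝ) ^ n := by
  by_cases ha : a = 0
  · simp only [ha, zero_dotProduct, zero_add, if_true]
    split_ifs <;> simp [ZMod.card, pow_succ]
  · have := prime_mul_sum_dotProduct (fun x => if x + c = 0 then (1 : ℝ) else 0) ha
    simp only [Finset.mul_sum, mul_ite, mul_one, mul_zero, ← eq_neg_iff_add_eq_zero,
      Finset.sum_ite_eq', Finset.mem_univ, if_true] at this
    simp only [← eq_neg_iff_add_eq_zero, this, ha, if_false]

/-! ### The span of the oracles -/

theorem heisenbergOracle_apply (A : heisenberg p n) (i j : Fin (n + 2) → ZMod p) :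
    (heisenbergOracle p n A : Matrix _ _ ℂ) i j =
      if vecEquiv p n i = heisAct (heisEquiv p n A) (vecEquiv p n j) then 1 else 0 := by
  simp only [← vecEquiv_heisenbergAction, (vecEquiv p n).injective.eq_iff]
  rfl

theorem finrank_span_heisenbergOracle_le :
    (Module.finrank ℂ (Submodule.span ℂ (Set.range fun A =>
      (heisenbergOracle p n A : Matrix (Fin (n + 2) → ZMod p) (Fin (n + 2) → ZMod p) ℂ))) : ℝ) ≤
      (p : ℝ) ^ (2 * n + 1) - ((p : ℝ) ^ n - 1) ^ 2 := by
  classical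
  let O : (Fin n → ZMod p) × (Fin n → ZMod p) × ZMod p →
      Matrix (Fin (n + 2) → ZMod p) (Fin (n + 2) → ZMod p) ℂ :=
    fun g => heisenbergOracle p n ((heisEquiv p n).symm g)
  let X : Finset (Fin n → ZMod p) := {0}ᶜ
  -- For a, b ≠ 0 the relation expresses O(a, b, 0) through oracles indexed by `S`, making (p^n -
  -- 1)^2 of them redundant.
  let S : Finset ((Fin n → ZMod p) × (Fin n → ZMod p) × ZMod p) := (X ×ˢ X ×ˢ {0})ᶜ
  have hrel : ∀ a b, ∑ c, O (a, b, c) + ∑ c, O (0, 0, c) =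
      ∑ c, O (a, 0, c) + ∑ c, O (0, b, c) := fun a b => by
    ext i j
    simp only [Matrix.add_apply, Matrix.sum_apply, O, heisenbergOracle_apply,
      Equiv.apply_symm_apply]
    exact sum_heisAct_relation (fun w => if vecEquiv p n i = w then (1 : ℂ) else 0) a b _
  have hS : ∀ g ∈ S, O g ∈ Submodule.span ℂ (S.image O : Set (Matrix _ _ ℂ)) := fun g hg =>
    Submodule.subset_span (by exact_mod_cast Finset.mem_image_of_mem O hg)
  have hspan : Submodule.span ℂ (Set.range fun A =>
      (heisenbergOracle p n A : Matrix (Fin (n + 2) → ZMod p) (Fin (n + 2) → ZMod p) ℂ)) ≤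
      Submodule.span ℂ (S.image O : Set (Matrix _ _ ℂ)) := by
    rw [Submodule.span_le]
    rintro _ ⟨A, rfl⟩
    have hA : (heisenbergOracle p n A : Matrix _ _ ℂ) = O (heisEquiv p n A) := by simp [O]
    simp only [hA]
    generalize heisEquiv p n A = g
    by_cases hg : g ∈ S
    · exact hS g hg
    · obtain ⟨a, b, c⟩ := g
      have hc : c = 0 := by
        simp only [S, Finset.mem_compl, not_not, Finset.mem_product, Finset.mem_singleton] at hg
        exact hg.2.2
      subst hc
      have h1 : O (a, b, 0) = ∑ c, O (a, 0, c) + ∑ c, O (0, b, c) - ∑ c, O (0, 0, c)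
          - ∑ c ∈ {0}ᶜ, O (a, b, c) := by
        rw [← hrel, ← Finset.sum_add_sum_compl {0}, Finset.sum_singleton]
        abel
      rw [SetLike.mem_coe, h1]
      refine sub_mem (sub_mem (add_mem ?_ ?_) ?_) ?_ <;>
      · refine Submodule.sum_mem _ fun c hc => hS _ ?_
        simp_all [S, X, eq_comm]
  have hcard : (S.card : ℝ) = (p : ℝ) ^ (2 * n + 1) - ((p : ℝ) ^ n - 1) ^ 2 := by
    have hp : 1 ≤ p ^ n := Nat.one_le_pow _ _ (Fact.out : p.Prime).pos
    have h1 := Finset.card_add_card_compl (X ×ˢ X ×ˢ ({0} : Finset (ZMod p)))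
    have h2 : (X.card : ℝ) = (p : ℝ) ^ n - 1 := by
      simp [X, Finset.card_compl, ZMod.card, Nat.cast_sub hp]
    have h3 := congrArg (Nat.cast : ℕ → ℝ) h1
    simp only [Finset.card_product, Finset.card_singleton, Fintype.card_prod, Fintype.card_pi,
      ZMod.card, Finset.prod_const, Finset.card_univ, Fintype.card_fin] at h3
    push_cast at h3
    rw [h2] at h3
    linear_combination h3
  rw [← hcard]
  exact_mod_cast (Submodule.finrank_mono hspan).trans
    ((finrank_span_finset_le_card _).trans Finset.card_image_le)

/-! ### The optimal states -/

/-- The Gram function of the state with amplitudes `fibreAmp s t`. -/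
noncomputable def fibreGram (s t : (Fin n → ZMod p) × ZMod p → ℝ)
    (g : (Fin n → ZMod p) × (Fin n → ZMod p) × ZMod p) : ℝ :=
  ∑ v, ∑ w, fibreAmp s t v w * fibreAmp s t (heisAct g v) w

theorem sum_dotProduct_eq_zero_sub_one (a : Fin n → ZMod p) :
    ∑ y : Fin n → ZMod p, (if y = 0 then 0 else (if a ⬝ᵥ y = 0 then (p : ℝ) else 0) - 1) =
      if a = 0 then ((p : ℝ) - 1) * ((p : ℝ) ^ n - 1) else 1 - (p : ℝ) := by
  have h : ∀ y : Fin n → ZMod p,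
      (if y = 0 then 0 else (if a ⬝ᵥ y = 0 then (p : ℝ) else 0) - 1) =
      (if a ⬝ᵥ y + 0 = 0 then (p : ℝ) else 0) - 1 - (if y = 0 then (p : ℝ) - 1 else 0) := by
    intro y
    by_cases hy : y = 0 <;> simp [hy]
  simp only [h, Finset.sum_sub_distrib, prime_mul_card_dotProduct_eq]
  simp only [if_true, Finset.sum_const, Finset.card_univ, Fintype.card_pi, ZMod.card,
    Finset.prod_const, Fintype.card_fin, Finset.sum_ite_eq', Finset.mem_univ, nsmul_eq_mul,
    mul_one]
  push_cast
  split_ifs <;> ring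

theorem exists_fibreGram_eq_heisKernel {D : ℝ} (hD : 0 < D) :
    ∃ s t : (Fin n → ZMod p) × ZMod p → ℝ, ∀ g, fibreGram s t g = heisKernel g / D := by
  have hp : (1 : ℝ) < p := by exact_mod_cast (Fact.out : p.Prime).one_lt
  have hp1 : (0 : ℝ) < p - 1 := by linarith
  -- On z = 1 the sum-zero part contains each irreducible of dimension p^n once (weight p^n/D), and
  -- the constants contain each character of b once (weight 1/D). On z = 0, y ≠ 0, the sum-zero part
  -- contains each nontrivial character of a exactly p - 1 times. The trivial character is already
  -- counted on z = 1.
  let S : (Fin n → ZMod p) × ZMod p → ℝ := fun u =>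
    if u.2 = 1 then (p : ℝ) ^ n / D else if u.2 = 0 ∧ u.1 ≠ 0 then 1 / (D * (p - 1)) else 0
  let T : (Fin n → ZMod p) × ZMod p → ℝ := fun u => if u.2 = 1 then 1 / D else 0
  have hS : ∀ u, 0 ≤ S u := fun u => by dsimp only [S]; split_ifs <;> positivity
  have hT : ∀ u, 0 ≤ T u := fun u => by dsimp only [T]; split_ifs <;> positivity
  refine ⟨fun u => √(S u), fun u => √(T u), fun ⟨a, b, c⟩ => ?_⟩
  rw [fibreGram, sum_fibreAmp_mul]
  simp only [Real.sq_sqrt (hS _), Real.sq_sqrt (hT _)]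
  have h : ∀ u : (Fin n → ZMod p) × ZMod p, (if u.2 • b = 0 then
        S u * ((if a ⬝ᵥ u.1 + c * u.2 = 0 then (p : ℝ) else 0) - 1) + T u else 0) =
      (if u.2 = 1 then (if b = 0 then (p : ℝ) ^ n / D *
        ((if a ⬝ᵥ u.1 + c = 0 then (p : ℝ) else 0) - 1) + 1 / D else 0) else 0) +
      (if u.2 = 0 then 1 / (D * (p - 1)) *
        (if u.1 = 0 then 0 else (if a ⬝ᵥ u.1 = 0 then (p : ℝ) else 0) - 1) else 0) := by
    rintro ⟨y, z⟩
    by_cases h1 : z = 1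
    · simp [h1, S, T]
    · by_cases h0 : z = 0
      · by_cases hy : y = 0 <;> simp [h0, hy, S, T]
      · simp [h0, h1, S, T]
  simp only [h, Finset.sum_add_distrib, Fintype.sum_prod_type, Finset.sum_ite_eq',
    Finset.mem_univ, if_true, ← Finset.mul_sum, sum_dotProduct_eq_zero_sub_one,
    Finset.sum_ite_irrel, Finset.sum_sub_distrib, prime_mul_card_dotProduct_eq, heisKernel]
  simp only [Finset.sum_const, Finset.card_univ, Fintype.card_pi, ZMod.card,
    Finset.prod_const, Fintype.card_fin, nsmul_eq_mul, mul_one]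
  push_cast
  by_cases ha : a = 0 <;> by_cases hb : b = 0 <;> by_cases hc : c = 0 <;> simp [ha, hb, hc] <;>
    field_simp <;> ring

theorem exists_fibreGram_eq_ite :
    ∃ s t : (Fin n → ZMod p) × ZMod p → ℝ, ∀ g, fibreGram s t g = if g.1 = 0 then 1 else 0 := by
  have hp : (1 : ℝ) < p := by exact_mod_cast (Fact.out : p.Prime).one_lt
  have hp1 : (0 : ℝ) < p - 1 := by linarith
  -- Each of the p^n characters of a gets total weight 1/p^n, so their weighted sum is the indicator
  -- of a = 0. The trivial one comes from the constants on the fibre y = 0, z = 0.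
  let S : (Fin n → ZMod p) × ZMod p → ℝ := fun u =>
    if u.2 = 0 ∧ u.1 ≠ 0 then 1 / ((p : ℝ) ^ n * (p - 1)) else 0
  let T : (Fin n → ZMod p) × ZMod p → ℝ := fun u =>
    if u.2 = 0 ∧ u.1 = 0 then 1 / (p : ℝ) ^ n else 0
  have hS : ∀ u, 0 ≤ S u := fun u => by dsimp only [S]; split_ifs <;> positivity
  have hT : ∀ u, 0 ≤ T u := fun u => by dsimp only [T]; split_ifs <;> positivity
  refine ⟨fun u => √(S u), fun u => √(T u), fun ⟨a, b, c⟩ => ?_⟩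
  rw [fibreGram, sum_fibreAmp_mul]
  simp only [Real.sq_sqrt (hS _), Real.sq_sqrt (hT _)]
  have h : ∀ u : (Fin n → ZMod p) × ZMod p, (if u.2 • b = 0 then
        S u * ((if a ⬝ᵥ u.1 + c * u.2 = 0 then (p : ℝ) else 0) - 1) + T u else 0) =
      (if u.2 = 0 then 1 / ((p : ℝ) ^ n * (p - 1)) *
        (if u.1 = 0 then 0 else (if a ⬝ᵥ u.1 = 0 then (p : ℝ) else 0) - 1) +
          (if u.1 = 0 then 1 / (p : ℝ) ^ n else 0) else 0) := by
    rintro ⟨y, z⟩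
    by_cases h0 : z = 0
    · by_cases hy : y = 0 <;> simp [h0, hy, S, T]
    · simp [h0, S, T]
  simp only [h, Finset.sum_add_distrib, Fintype.sum_prod_type, Finset.sum_ite_eq',
    Finset.mem_univ, if_true, ← Finset.mul_sum, sum_dotProduct_eq_zero_sub_one]
  by_cases ha : a = 0 <;> simp [ha] <;> field_simp <;> ring

/-- The state with amplitudes `fibreAmp s t`. -/
noncomputable def fibreState (s t : (Fin n → ZMod p) × ZMod p → ℝ)
    (v : (Fin (n + 2) → ZMod p) × (Fin (n + 2) → ZMod p)) : ℝ :=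
  fibreAmp s t (vecEquiv p n v.1) (vecEquiv p n v.2)

theorem sum_fibreState_mul (s t : (Fin n → ZMod p) × ZMod p → ℝ) (A : heisenberg p n) :
    ∑ v, ∑ w, fibreState s t (v, w) * fibreState s t (heisenbergAction p n A v, w) =
      fibreGram s t (heisEquiv p n A) := by
  simp only [fibreState, vecEquiv_heisenbergAction, fibreGram]
  rw [← Equiv.sum_comp (vecEquiv p n)]
  exact Finset.sum_congr rfl fun v _ => Equiv.sum_comp (vecEquiv p n) fun w =>
    fibreAmp s t (vecEquiv p n v) w *
      fibreAmp s t (heisAct (heisEquiv p n A) (vecEquiv p n v)) w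

theorem exists_isTightOrbit_one {D : ℝ} (hD : D = (p : ℝ) ^ (2 * n + 1) - ((p : ℝ) ^ n - 1) ^ 2) :
    ∃ r : (Fin (n + 2) → ZMod p) × (Fin (n + 2) → ZMod p) → ℝ,
      QuantumOracle.IsTightOrbit
        (QuantumOracle.extendAction (heisenbergAction p n) (Fin (n + 2) → ZMod p)) r
        ((p : ℝ) ^ (2 * n + 1) / D) := by
  have hp : (1 : ℝ) < p := by exact_mod_cast (Fact.out : p.Prime).one_lt
  have hDpos : 0 < D := by
    have h1 : (1 : ℝ) ≤ (p : ℝ) ^ n := one_le_pow₀ hp.le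
    have h2 : (p : ℝ) ^ (2 * n + 1) = (p : ℝ) ^ n * (p : ℝ) ^ n * p := by ring
    rw [hD, h2]
    nlinarith [mul_pos (zero_lt_one.trans_le h1) (zero_lt_one.trans_le h1)]
  obtain ⟨s, t, hst⟩ := exists_fibreGram_eq_heisKernel (p := p) (n := n) hDpos
  have hgram : ∀ A : heisenberg p n, ∑ w, fibreState s t w * fibreState s t
      (QuantumOracle.extendAction (heisenbergAction p n) (Fin (n + 2) → ZMod p) A w) =
      heisKernel (heisEquiv p n A) / D := fun A => by
    rw [← hst, ← sum_fibreState_mul, Fintype.sum_prod_type]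
    rfl
  refine ⟨fibreState s t, by positivity, ?_, fun v => ?_⟩
  · have h1 := hgram 1
    simp only [map_one, Equiv.Perm.one_apply, (heisEquiv_eq_zero_iff _).2] at h1
    rw [h1, div_eq_one_iff_eq hDpos.ne', hD]
    simp [heisKernel]
    ring
  · simp only [hgram]
    -- The workspace coordinate is untouched by the group, so the kernel identity applies to each
    -- slice of the state.
    have h1 := sum_heisKernel_mul (fun w => fibreAmp s t w (vecEquiv p n v.2)) (vecEquiv p n v.1)
    rw [← Equiv.sum_comp (heisEquiv p n)] at h1
    simp only [← vecEquiv_heisenbergAction] at h1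
    simp only [div_mul_eq_mul_div, ← Finset.sum_div]
    congr 1

theorem QuantumOracle.isTightOrbit_of_gram_eq_ite {G κ : Type*} [Group G] [Fintype G]
    [DecidableEq G] [Fintype κ] {σ : G →* Equiv.Perm κ} {r : κ → ℝ}
    (h : ∀ g, ∑ w, r w * r (σ g w) = if g = 1 then 1 else 0) : IsTightOrbit σ r 1 where
  pos := one_pos
  norm := by simpa using h 1
  frame v := by simp [h]

theorem exists_isTightOrbit_two :
    ∃ r : ((Fin (n + 2) → ZMod p) × (Fin (n + 2) → ZMod p)) × (Fin (n + 2) → ZMod p) → ℝ,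
      QuantumOracle.IsTightOrbit (QuantumOracle.extendAction
        (QuantumOracle.pairAction (heisenbergAction p n)) (Fin (n + 2) → ZMod p)) r 1 := by
  classical
  obtain ⟨s, t, hst⟩ := exists_fibreGram_eq_ite (p := p) (n := n)
  -- The stabilizer of `v₀` is b = 0, c = 0. The Gram function of the product state is the product
  -- of the indicators of this and of a = 0.
  let v₀ : Fin (n + 2) → ZMod p := (vecEquiv p n).symm (0, 0, 1)
  refine ⟨fun v => (if v.1.1 = v₀ then 1 else 0) * fibreState s t (v.1.2, v.2),
    QuantumOracle.isTightOrbit_of_gram_eq_ite fun A => ?_⟩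
  have h : ∀ u v w, (if u = v₀ then 1 else 0) * fibreState s t (v, w) *
      ((if heisenbergAction p n A u = v₀ then 1 else 0) *
        fibreState s t (heisenbergAction p n A v, w)) =
      if u = v₀ then (if heisenbergAction p n A v₀ = v₀ then
        fibreState s t (v, w) * fibreState s t (heisenbergAction p n A v, w) else 0) else 0 := by
    intro u v w
    by_cases hu : u = v₀ <;> simp [hu]
  have h1 : ∑ u, ∑ v, ∑ w, (if u = v₀ then 1 else 0) * fibreState s t (v, w) *
      ((if heisenbergAction p n A u = v₀ then 1 else 0) *
        fibreState s t (heisenbergAction p n A v, w)) = if A = 1 then 1 else 0 := by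
    simp only [h, Finset.sum_ite_irrel, Finset.sum_const_zero, sum_fibreState_mul, hst,
      Finset.sum_ite_eq', Finset.mem_univ, if_true]
    rw [← ite_and]
    refine if_congr ?_ rfl rfl
    rw [heisenbergAction_eq_self_iff, Equiv.apply_symm_apply, ← heisEquiv_eq_zero_iff]
    generalize heisEquiv p n A = g
    obtain ⟨a, b, c⟩ := g
    simp [heisAct]
    tauto
  rw [← h1, Fintype.sum_prod_type, Fintype.sum_prod_type]
  rfl

/-- The optimal success probability is the dimension of the span of the oracles divided by the
order of the group. -/
theorem heisenberg_optimal_eq :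
    ((p : ℝ) ^ (2 * n + 1) - ((p : ℝ) ^ n - 1) ^ 2) / (p : ℝ) ^ (2 * n + 1) =
      1 - 1 / (p : ℝ) + 2 / (p : ℝ) ^ (n + 1) - 1 / (p : ℝ) ^ (2 * n + 1) := by
  have hp : (p : ℝ) ≠ 0 := by exact_mod_cast (Fact.out : p.Prime).ne_zero
  field_simp
  ring

end Heisenberg

/-! ### Matching the bounds -/

theorem theorem6p1 (p n : ℕ) [Fact p.Prime] (hn : 1 ≤ n) :
    -- the optimal single-query success probability, in the adaptive and the nonadaptive model
    IsGreatest
      {q : ℝ | ∃ A : QuantumOracle.AdaptiveAlgorithm 1 (Fin (n + 2) → ZMod p) (heisenberg p n),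
        A.successProb (heisenbergOracle p n) id = q}
      (1 - 1 / (p : ℝ) + 2 / (p : ℝ) ^ (n + 1) - 1 / (p : ℝ) ^ (2 * n + 1)) ∧
    IsGreatest
      {q : ℝ | ∃ A : QuantumOracle.NonadaptiveAlgorithm 1 (Fin (n + 2) → ZMod p) (heisenberg p n),
        A.successProb (heisenbergOracle p n) id = q}
      (1 - 1 / (p : ℝ) + 2 / (p : ℝ) ^ (n + 1) - 1 / (p : ℝ) ^ (2 * n + 1)) ∧
    -- two queries suffice for certainty, in both models
    (∃ A : QuantumOracle.AdaptiveAlgorithm 2 (Fin (n + 2) → ZMod p) (heisenberg p n),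
      A.successProb (heisenbergOracle p n) id = 1) ∧
    (∃ A : QuantumOracle.NonadaptiveAlgorithm 2 (Fin (n + 2) → ZMod p) (heisenberg p n),
      A.successProb (heisenbergOracle p n) id = 1) ∧
    -- the classical base size
    IsLeast
      {t : ℕ | ∃ ω : Fin t → (Fin (n + 2) → ZMod p),
        QuantumOracle.IsBase (heisenbergAction p n) ω}
      (n + 1) := by
  have hcard : (Fintype.card (heisenberg p n) : ℝ) = (p : ℝ) ^ (2 * n + 1) := by
    exact_mod_cast card_heisenberg
  have hbound := div_le_div_of_nonneg_right (finrank_span_heisenbergOracle_le (p := p) (n := n))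
    (Nat.cast_nonneg (α := ℝ) (Fintype.card (heisenberg p n)))
  rw [← heisenberg_optimal_eq]
  rw [hcard] at hbound
  obtain ⟨r₁, h₁⟩ := exists_isTightOrbit_one (p := p) (n := n) rfl
  obtain ⟨r₂, h₂⟩ := exists_isTightOrbit_two (p := p) (n := n)
  refine ⟨⟨?_, ?_⟩, ⟨?_, ?_⟩, ?_, ?_, exists_isBase_heisenbergAction, ?_⟩
  · rw [← one_div_div]
    exact h₁.exists_adaptiveAlgorithm_one
  · rintro _ ⟨A, rfl⟩
    refine (A.successProb_le _).trans ?_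
    rw [hcard]
    exact hbound
  · rw [← one_div_div]
    exact h₁.exists_nonadaptiveAlgorithm_one
  · rintro _ ⟨A, rfl⟩
    refine (A.successProb_le _).trans ?_
    rw [hcard]
    exact hbound
  · rw [← one_div_one]
    exact h₂.exists_adaptiveAlgorithm_two
  · rw [← one_div_one]
    exact h₂.exists_nonadaptiveAlgorithm_two
  · rintro t ⟨ω, hω⟩
    exact succ_le_of_isBase_heisenbergAction hω
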